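/- Let $\mathcal{X}$ be a measurable space and let $\mathcal{H} \subseteq \{0,1,\star\}^{\mathcal{X}}$ be a partial hypothesis class of VC dimension $d$, that is, $d$ is the largest cardinality of a finite set $U \subseteq \mathcal{X}$ that is shattered by $\mathcal{H}$, where $U$ is shattered if every function $U \to \{0,1\}$ is the restriction to $U$ of a member of $\mathcal{H}$. For a probability measure $P$ on $\mathcal{X}\times\{0,1\}$ and $f : \mathcal{X} \to \{0,1,\star\}$ let $\mathrm{err}(f; P) = P\{(x,y) : f(x) \ne y\}$, and call $P$ realizable if $\mathrm{err}(f^*; P) = 0$ for some $f^* \in \mathcal{H}$. (Measurability is understood as follows: for all $m$ and $b \in \{0,1\}^m$, the set of $(x_1,\dots,x_m) \in \mathcal{X}^m$ for which some $h \in \mathcal{H}$ satisfies $h(x_i) = b_i$ for all $i$ is measurable up to null sets of the $m$-fold product of the marginal of $P$ on $\mathcal{X}$.) Put $C = 4.81$. Then there is a predictor $\widehat f$, assigning to every finite sample $S$ of points of $\mathcal{X} \times \{0,1\}$ a function $\widehat f(\cdot\,; S) : \mathcal{X} \to \{0,1,\star\}$, such that for every $\delta \in (0,1)$, every $n \ge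 1$ and every realizable $P$, a sample $S \sim P^n$ satisfies \[ \mathrm{err}\big(\widehat f(\cdot\,; S); P\big) \le 2C\left(\frac{d}{n} + \frac{1}{n}\log\left(\frac{2}{\delta}\right)\right) \] with probability at least $1-\delta$ over the randomness of $S$, where $\log$ is the natural logarithm. -/

import Mathlib

open MeasureTheory

namespace PartialLearning

/-- The label set `{0, 1, ⋆}`: `some false` is `0`, `some true` is `1`, and `none` is `⋆`. -/
abbrev PLabel : Type := Option Bool

/-- A partial hypothesis on the instance space `X`, that is, a function `X → {0, 1, ⋆}`. -/
abbrev PHyp (X : Type*) : Type _ := X → PLabel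

/-- A finite set `s` of instances is shattered by `H` if `{0,1}^s ⊆ H|_s`. -/
def Shatters {X : Type*} (H : Set (PHyp X)) (s : Finset X) : Prop :=
  ∀ b : s → Bool, ∃ h ∈ H, ∀ x : s, h x = some (b x)

/-- `H` has VC dimension `d`: `d` is the largest cardinality of a finite set shattered by `H`. -/
def HasVCDim {X : Type*} (H : Set (PHyp X)) (d : ℕ) : Prop :=
  IsGreatest {k : ℕ | ∃ s : Finset X, s.card = k ∧ Shatters H s} d

/-- A predictor maps a training sample of any size (labelled by `0` and `1`) and a test point to a
label in `{0, 1, ⋆}`; `f n S` is the hypothesis that `f` outputs on the sample `S`. -/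
abbrev Predictor (X : Type*) : Type _ := (n : ℕ) → (Fin n → X × Bool) → PHyp X

/-- The risk of `f` for the `0/1` loss: the `P`-probability that `f x ≠ y`. (For a set that is not
measurable, the value of `P` is its outer measure.) -/
noncomputable def err {X : Type*} [MeasurableSpace X] (f : PHyp X) (P : Measure (X × Bool)) : ℝ :=
  P.real {z : X × Bool | f z.1 ≠ some z.2}

/-- `P` on `X × {0,1}` is realizable by `H` if some `f ∈ H` has risk zero under `P`. -/
def Realizable {X : Type*} [MeasurableSpace X] (H : Set (PHyp X)) (P : Measure (X × Bool)) :
    Prop :=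
  ∃ f ∈ H, err f P = 0

/-- The tuples of instances on which the binary label pattern `b` is produced by a member of `H`. -/
def patternSet {X : Type*} (H : Set (PHyp X)) {m : ℕ} (b : Fin m → Bool) : Set (Fin m → X) :=
  {x | ∃ h ∈ H, ∀ i, h (x i) = some (b i)}

/-- The measurability convention: the events "the pattern `b` is realized by `H` on `m`
independent instances" are measurable up to null sets. It holds for every `P` if `H` is a
countable class of measurable functions, and for every `H` if `P` is carried by countably many
measurable points. -/
def PatternMeasurable {X : Type*} [MeasurableSpace X] (H : Set (PHyp X))
    (P : Measure (X × Bool)) : Prop :=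
  ∀ (m : ℕ) (b : Fin m → Bool),
    NullMeasurableSet (patternSet H b) (Measure.pi fun _ : Fin m => P.map Prod.fst)

end PartialLearning

namespace PartialLearning

/-! The predictor is a majority vote over one-inclusion predictors trained on the prefixes of length
`t ≥ n / 4`. The one-inclusion graph of the binary patterns realized on `t + 1` points has edge
density at most `d` (`sum_card_lowerEnds_le`), so Hall's theorem orients it with out-degree at most
`d` (`exists_orientation`). Predicting hidden labels along the orientation and averaging over
relabellings (`exists_equivariant_prediction`) gives leave-one-out losses with sum at most `d`.

Hence, given the first `t + 1` examples up to order, the last loss has mean at most `d / (t + 1)`.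
Later losses are symmetric in these examples, so the rounds can be peeled off one at a time, which
bounds an exponential moment of the observed losses (`lintegral_prod_exp_le`). A supermartingale
compares conditional risks with observed losses (`lintegral_prod_exp_nextRisk_sub_le`), and together
they bound the sum of the conditional risks (`measure_sum_nextRisk_gt_le`).

A wrong vote forces total loss at least half the number of voters, so the risk of the vote is at
most twice the average conditional risk. Dropping the first quarter of the rounds keeps the sum of
`1 / (t + 1)` bounded, which avoids a factor `log n`. -/

open Finset in
/-- The lower endpoints of the edges of the one-inclusion graph of `𝒜` in direction `i`. -/
def lowerEnds {α : Type*} [DecidableEq α] (𝒜 : Finset (Finset α)) (i : α) : Finset (Finset α) :=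
  {s ∈ 𝒜 | i ∉ s ∧ insert i s ∈ 𝒜}

/-! ### Edge density and orientation of one-inclusion graphs. -/

section OneInclusion

open Finset

variable {α : Type*} [DecidableEq α]

theorem mem_lowerEnds {𝒜 : Finset (Finset α)} {i : α} {s : Finset α} :
    s ∈ lowerEnds 𝒜 i ↔ s ∈ 𝒜 ∧ i ∉ s ∧ insert i s ∈ 𝒜 := by
  simp [lowerEnds]

/-- Edge counts are supermodular: an edge of either family survives in the union, and a common edge
also in the intersection. -/
theorem card_lowerEnds_add_card_lowerEnds_le (𝒜 ℬ : Finset (Finset α)) (i : α) :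
    #(lowerEnds 𝒜 i) + #(lowerEnds ℬ i) ≤
      #(lowerEnds (𝒜 ∪ ℬ) i) + #(lowerEnds (𝒜 ∩ ℬ) i) := by
  rw [← card_union_add_card_inter]
  gcongr <;> intro s <;> simp only [mem_union, mem_inter, mem_lowerEnds] <;> tauto

theorem card_lowerEnds_eq_add {𝒜 : Finset (Finset α)} {a i : α} (hai : i ≠ a) :
    #(lowerEnds 𝒜 i) =
      #(lowerEnds (𝒜.nonMemberSubfamily a) i) + #(lowerEnds (𝒜.memberSubfamily a) i) := by
  rw [← card_memberSubfamily_add_card_nonMemberSubfamily a (lowerEnds 𝒜 i), add_comm]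
  congr 2 <;> ext s <;>
    simp only [mem_memberSubfamily, mem_nonMemberSubfamily, mem_lowerEnds, mem_insert, hai,
      hai.symm, Finset.insert_comm i a, false_or] <;> tauto

theorem lowerEnds_self (𝒜 : Finset (Finset α)) (a : α) :
    lowerEnds 𝒜 a = 𝒜.nonMemberSubfamily a ∩ 𝒜.memberSubfamily a := by
  ext s
  simp only [mem_inter, mem_memberSubfamily, mem_nonMemberSubfamily, mem_lowerEnds]
  tauto

theorem notMem_of_shatters {𝒜 : Finset (Finset α)} {s : Finset α} {a : α}
    (h𝒜 : ∀ t ∈ 𝒜, a ∉ t) (hs : 𝒜.Shatters s) : a ∉ s := fun ha => by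
  obtain ⟨u, hu, hsu⟩ := hs.exists_superset
  exact h𝒜 u hu (hsu ha)

theorem shatters_of_shatters_union_subfamily {𝒜 : Finset (Finset α)} {s : Finset α} {a : α}
    (hs : (𝒜.nonMemberSubfamily a ∪ 𝒜.memberSubfamily a).Shatters s) : 𝒜.Shatters s := by
  have ha : a ∉ s := notMem_of_shatters (by
    intro t
    simp only [mem_union, mem_memberSubfamily, mem_nonMemberSubfamily]
    tauto) hs
  intro t ht
  obtain ⟨u, hu, rfl⟩ := hs ht
  simp only [mem_union, mem_memberSubfamily, mem_nonMemberSubfamily] at hu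
  rcases hu with hu | hu
  · exact ⟨u, hu.1, rfl⟩
  · exact ⟨_, hu.1, by rw [inter_insert_of_notMem ha]⟩

/-- Sets in the intersection extend both with and without `a`; this is why its VC dimension drops by
one. -/
theorem shatters_insert_of_shatters_inter_subfamily {𝒜 : Finset (Finset α)} {s : Finset α} {a : α}
    (hs : (𝒜.nonMemberSubfamily a ∩ 𝒜.memberSubfamily a).Shatters s) :
    𝒜.Shatters (insert a s) := by
  intro t ht
  obtain ⟨u, hu, hut⟩ := hs (t := t.erase a) (by
    intro x hx
    have := ht (mem_of_mem_erase hx)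
    simp only [mem_insert] at this
    exact this.resolve_left (ne_of_mem_erase hx))
  simp only [mem_inter, mem_memberSubfamily, mem_nonMemberSubfamily] at hu
  by_cases hat : a ∈ t
  · refine ⟨insert a u, hu.2.1, ?_⟩
    rw [← insert_inter_distrib, hut, insert_erase hat]
  · refine ⟨u, hu.1.1, ?_⟩
    rw [insert_inter_of_notMem hu.2.2, hut, erase_eq_of_notMem hat]

/-- The edge density of a one-inclusion graph is at most the VC dimension. -/
theorem sum_card_lowerEnds_le (u : Finset α) (𝒜 : Finset (Finset α)) (d : ℕ)
    (hu : ∀ s ∈ 𝒜, s ⊆ u) (hd : ∀ s, 𝒜.Shatters s → #s ≤ d) :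
    ∑ i ∈ u, #(lowerEnds 𝒜 i) ≤ d * #𝒜 := by
  induction u using Finset.induction_on generalizing 𝒜 d with
  | empty => simp
  | insert a u ha ih =>
    set A := 𝒜.nonMemberSubfamily a with hA
    set B := 𝒜.memberSubfamily a with hB
    have hAu : ∀ s ∈ A, s ⊆ u := fun s hs => by
      rw [hA, mem_nonMemberSubfamily] at hs
      exact (subset_insert_iff_of_notMem hs.2).1 (hu s hs.1)
    have hBu : ∀ s ∈ B, s ⊆ u := fun s hs => by
      rw [hB, mem_memberSubfamily] at hs
      exact (subset_insert_iff_of_notMem hs.2).1 ((subset_insert a s).trans (hu _ hs.1))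
    have hU : ∑ i ∈ u, #(lowerEnds (A ∪ B) i) ≤ d * #(A ∪ B) :=
      ih _ _ (fun s hs => (mem_union.1 hs).elim (hAu s) (hBu s))
        fun s hs => hd s (shatters_of_shatters_union_subfamily hs)
    -- The drop in dimension frees `#(A ∩ B)`, exactly the number of edges in direction `a`.
    -- Nonemptiness makes `{a}` shattered, so `d - 1` is a genuine predecessor.
    have hI : ∑ i ∈ u, #(lowerEnds (A ∩ B) i) + #(A ∩ B) ≤ d * #(A ∩ B) := by
      rcases (A ∩ B).eq_empty_or_nonempty with h0 | h0
      · simp [h0, lowerEnds]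
      · have h1 : 1 ≤ d := by
          simpa using hd _ (shatters_insert_of_shatters_inter_subfamily (shatters_empty.2 h0))
        obtain ⟨e, rfl⟩ : ∃ e, d = e + 1 := ⟨d - 1, by omega⟩
        have := ih (A ∩ B) e (fun s hs => hAu s (mem_inter.1 hs).1) fun s hs => by
          have h2 := hd _ (shatters_insert_of_shatters_inter_subfamily hs)
          rw [card_insert_of_notMem] at h2
          · omega
          · exact notMem_of_shatters (fun t ht => by
              rw [mem_inter, hB, mem_memberSubfamily] at ht
              exact ht.2.2) hs
        rw [add_mul, one_mul]
        omega
    have hS : ∑ i ∈ u, #(lowerEnds 𝒜 i) ≤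
        ∑ i ∈ u, #(lowerEnds (A ∪ B) i) + ∑ i ∈ u, #(lowerEnds (A ∩ B) i) := by
      rw [← sum_add_distrib]
      refine sum_le_sum fun i hi => ?_
      rw [card_lowerEnds_eq_add (a := a) (fun h => ha (h ▸ hi))]
      exact card_lowerEnds_add_card_lowerEnds_le _ _ _
    have hc : #𝒜 = #(A ∪ B) + #(A ∩ B) := by
      rw [card_union_add_card_inter, add_comm, card_memberSubfamily_add_card_nonMemberSubfamily]
    rw [sum_insert ha, lowerEnds_self, ← hA, ← hB, hc, mul_add]
    omega

/-- A one-inclusion graph has an orientation of out-degree at most the VC dimension. Here `q i s`,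
for `i ∉ s`, says that the edge between `s` and `insert i s` points to `insert i s`. -/
theorem exists_orientation [Fintype α] (𝒜 : Finset (Finset α)) (d : ℕ)
    (hd : ∀ s, 𝒜.Shatters s → #s ≤ d) :
    ∃ q : α → Finset α → Prop, ∀ v ∈ 𝒜, ∀ I : Finset α,
      (∀ i ∈ I, ¬ (q i (v.erase i) ↔ i ∈ v)) → #I ≤ d := by
  classical
  let E := Σ i, {s // s ∈ lowerEnds 𝒜 i}
  let ends : E → Finset (Finset α) := fun e => {e.2.1, insert e.1 e.2.1}
  -- Each edge claims one of its ends, which becomes its tail, and one of `d` slots there.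
  -- Injectivity of the claims bounds the out-degree.
  let t : E → Finset (Finset α × Fin d) := fun e => ends e ×ˢ univ
  have hall : ∀ J : Finset E, #J ≤ #(J.biUnion t) := by
    intro J
    have h1 : J.biUnion t = (J.biUnion ends) ×ˢ univ := by
      ext ⟨x, y⟩
      simp [t]
    have h2 : #J ≤ ∑ i, #(lowerEnds (J.biUnion ends) i) := by
      rw [← card_sigma]
      refine card_le_card_of_injOn (fun e => ⟨e.1, e.2.1⟩) ?_ ?_
      · rintro ⟨i, s, hs⟩ he
        have h3 := (mem_lowerEnds.1 hs).2.1
        simp only [coe_sigma, Set.mem_sigma_iff, mem_coe, true_and, mem_lowerEnds,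
          mem_biUnion, coe_univ, Set.mem_univ]
        exact ⟨⟨_, he, by simp [ends]⟩, h3, ⟨_, he, by simp [ends]⟩⟩
      · rintro ⟨i, s, hs⟩ - ⟨j, s', hs'⟩ - h
        simp only [Sigma.mk.injEq, heq_eq_eq] at h
        obtain ⟨rfl, rfl⟩ := h
        rfl
    have hsub : J.biUnion ends ⊆ 𝒜 := by
      intro s hs
      obtain ⟨⟨i, s', hs'⟩, -, h⟩ := mem_biUnion.1 hs
      have h3 := mem_lowerEnds.1 hs'
      simp only [ends, mem_insert, mem_singleton] at h
      rcases h with rfl | rfl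
      exacts [h3.1, h3.2.2]
    have h4 := sum_card_lowerEnds_le univ (J.biUnion ends) d (fun s _ => subset_univ s)
      fun s hs => hd s (hs.mono_left hsub)
    rw [h1, card_product, card_univ, Fintype.card_fin, mul_comm]
    exact h2.trans h4
  obtain ⟨o, ho, hot⟩ := (Finset.all_card_le_biUnion_card_iff_exists_injective t).1 hall
  -- Where there is no edge, the only possible vertex of `𝒜` is chosen, so no mistake occurs in that
  -- direction.
  refine ⟨fun i s => if h : s ∈ lowerEnds 𝒜 i then (o ⟨i, s, h⟩).1 = s else insert i s ∈ 𝒜, ?_⟩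
  intro v hv I hI
  have key : ∀ i ∈ I, ∃ h : v.erase i ∈ lowerEnds 𝒜 i, (o ⟨i, v.erase i, h⟩).1 = v := by
    intro i hi
    have h := hI i hi
    beta_reduce at h
    by_cases hl : v.erase i ∈ lowerEnds 𝒜 i
    · refine ⟨hl, ?_⟩
      rw [dif_pos hl] at h
      have h5 := (mem_product.1 (hot ⟨i, v.erase i, hl⟩)).1
      simp only [ends, mem_insert, mem_singleton] at h5
      by_cases hiv : i ∈ v
      · simp only [hiv, iff_true] at h
        rw [h5.resolve_left h, insert_erase hiv]
      · simp only [hiv, iff_false, not_not] at h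
        rw [h, erase_eq_of_notMem hiv]
    · exfalso
      rw [dif_neg hl] at h
      apply h
      by_cases hiv : i ∈ v
      · simpa [hiv, insert_erase hiv] using hv
      · simp only [hiv, iff_false]
        rw [mem_lowerEnds, erase_eq_of_notMem hiv] at hl
        rw [erase_eq_of_notMem hiv]
        tauto
  choose hk1 hk2 using fun i : I => key i.1 i.2
  have : Function.Injective fun i : I => (o ⟨i.1, v.erase i.1, hk1 i⟩).2 := by
    intro i j hij
    have h6 : o ⟨i.1, v.erase i.1, hk1 i⟩ = o ⟨j.1, v.erase j.1, hk1 j⟩ :=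
      Prod.ext ((hk2 i).trans (hk2 j).symm) hij
    exact Subtype.ext (congrArg Sigma.fst (ho h6))
  simpa using Fintype.card_le_of_injective _ this

end OneInclusion

/-! ### Leave-one-out predictions for binary classes. -/

/-- The label `b` as a real number. -/
def bit (b : Bool) : ℝ := if b then 1 else 0

/-- Every set of coordinates shattered by the binary class `F` has at most `d` elements. -/
def VCDimLE {ι : Type*} (F : Set (ι → Bool)) (d : ℕ) : Prop :=
  ∀ s : Finset ι, (∀ b : ι → Bool, ∃ v ∈ F, ∀ i ∈ s, v i = b i) → s.card ≤ d

/-- Erasing `i` from the support hides the label at `i`, and the mistakes at `v` are its outgoing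
edges. -/
theorem exists_prediction {ι : Type*} [Fintype ι] [DecidableEq ι] {F : Set (ι → Bool)} {d : ℕ}
    (hF : VCDimLE F d) :
    ∃ p : ι → (ι → Bool) → ℝ, (∀ i v, p i v ∈ Set.Icc (0 : ℝ) 1) ∧
      (∀ i v b, p i (Function.update v i b) = p i v) ∧
      ∀ v ∈ F, ∑ i, |p i v - bit (v i)| ≤ d := by
  classical
  let supp : (ι → Bool) → Finset ι := fun v => Finset.univ.filter fun i => v i = true
  let 𝒜 : Finset (Finset ι) := (Finset.univ.filter (· ∈ F)).image supp
  obtain ⟨q, hq⟩ := exists_orientation 𝒜 d (by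
    intro s hs
    refine hF s fun b => ?_
    obtain ⟨u, hu, hsu⟩ := hs (t := s.filter fun i => b i = true) (Finset.filter_subset _ _)
    simp only [𝒜, Finset.mem_image, Finset.mem_filter, Finset.mem_univ, true_and] at hu
    obtain ⟨v, hv, rfl⟩ := hu
    refine ⟨v, hv, fun i hi => ?_⟩
    have := congrArg (i ∈ ·) hsu
    simp only [supp, Finset.mem_inter, Finset.mem_filter, Finset.mem_univ, true_and, hi,
      eq_iff_iff] at this
    exact Bool.eq_iff_iff.2 this)
  refine ⟨fun i v => if q i ((supp v).erase i) then 1 else 0, fun i v => ?_, fun i v b => ?_,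
    fun v hv => ?_⟩
  · dsimp only
    split_ifs <;> simp
  · have : (supp (Function.update v i b)).erase i = (supp v).erase i := by
      ext j
      by_cases hj : j = i <;> simp [supp, hj]
    simp only [this]
  · have h1 := hq (supp v) (Finset.mem_image_of_mem _ (by simpa using hv))
      (Finset.univ.filter fun i => ¬ (q i ((supp v).erase i) ↔ i ∈ supp v)) (by simp)
    refine le_trans (le_of_eq ?_) (Nat.cast_le (α := ℝ).2 h1)
    rw [Finset.card_filter, Nat.cast_sum]
    refine Finset.sum_congr rfl fun i _ => ?_
    have h4 : i ∈ supp v ↔ v i = true := by simp [supp]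
    simp only [h4, bit]
    by_cases h2 : q i ((supp v).erase i) <;> by_cases h3 : v i = true <;> simp [h2, h3]

/-- Averaging over all relabellings makes the predictions depend on the pattern class in an
equivariant way. -/
theorem exists_equivariant_prediction (ι : Type*) [Fintype ι] [DecidableEq ι] (d : ℕ) :
    ∃ p : Set (ι → Bool) → ι → (ι → Bool) → ℝ, (∀ F i v, p F i v ∈ Set.Icc (0 : ℝ) 1) ∧
      (∀ F i v b, p F i (Function.update v i b) = p F i v) ∧
      (∀ F i v (σ : Equiv.Perm ι), p ((· ∘ σ.symm) ⁻¹' F) i (v ∘ σ) = p F (σ i) v) ∧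
      ∀ F, VCDimLE F d → ∀ v ∈ F, ∑ i, |p F i v - bit (v i)| ≤ d := by
  classical
  have h0 : ∀ F : Set (ι → Bool), ∃ p : ι → (ι → Bool) → ℝ, (∀ i v, p i v ∈ Set.Icc (0 : ℝ) 1) ∧
      (∀ i v b, p i (Function.update v i b) = p i v) ∧
      (VCDimLE F d → ∀ v ∈ F, ∑ i, |p i v - bit (v i)| ≤ d) := by
    intro F
    by_cases hF : VCDimLE F d
    · obtain ⟨p, h1, h2, h3⟩ := exists_prediction hF
      exact ⟨p, h1, h2, fun _ => h3⟩
    · exact ⟨fun _ _ => 0, by simp, by simp, fun h => absurd h hF⟩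
  choose p hp01 hpu hpd using h0
  set N : ℝ := (Fintype.card (Equiv.Perm ι) : ℝ) with hN
  have hN0 : 0 < N := by
    rw [hN]
    exact_mod_cast Fintype.card_pos
  have hNs : ∀ c : ℝ, ∑ _σ : Equiv.Perm ι, c = N * c := by simp [hN]
  -- Reindexing the group average by left multiplication gives equivariance. The loss bound survives
  -- since relabelling coordinates preserves the VC bound and the absolute value is convex.
  refine ⟨fun F i v => (∑ σ : Equiv.Perm ι, p ((· ∘ σ.symm) ⁻¹' F) (σ.symm i) (v ∘ σ)) / N,
    fun F i v => ⟨?_, ?_⟩, fun F i v b => ?_, fun F i v τ => ?_, fun F hF v hv => ?_⟩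
  · exact div_nonneg (Finset.sum_nonneg fun σ _ => (hp01 _ _ _).1) hN0.le
  · rw [div_le_one hN0]
    calc _ ≤ ∑ _σ : Equiv.Perm ι, (1 : ℝ) := Finset.sum_le_sum fun σ _ => (hp01 _ _ _).2
      _ = N := by rw [hNs, mul_one]
  · dsimp only
    congr 1
    refine Finset.sum_congr rfl fun σ _ => ?_
    rw [Function.update_comp_equiv, hpu]
  · dsimp only
    congr 1
    refine Fintype.sum_equiv (Equiv.mulLeft τ) _ _ fun σ => ?_
    have h1 : ((Equiv.mulLeft τ) σ).symm (τ i) = σ.symm i := by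
      rw [Equiv.symm_apply_eq]
      simp
    rw [h1]
    rfl
  · have h1 : ∀ σ : Equiv.Perm ι,
        ∑ i, |p ((· ∘ σ.symm) ⁻¹' F) (σ.symm i) (v ∘ σ) - bit (v i)| ≤ d := by
      intro σ
      have h2 : VCDimLE ((· ∘ σ.symm) ⁻¹' F) d := by
        intro s hs
        rw [← Finset.card_map σ.toEmbedding]
        refine hF _ fun b => ?_
        obtain ⟨w, hw, hwb⟩ := hs (b ∘ σ)
        refine ⟨_, hw, fun i hi => ?_⟩
        obtain ⟨j, hj, rfl⟩ := Finset.mem_map.1 hi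
        simpa using hwb j hj
      have h3 := hpd _ h2 (v ∘ σ) (by
        have : (v ∘ σ) ∘ σ.symm = v := by ext; simp
        simpa [this] using hv)
      refine le_trans (le_of_eq ?_) h3
      exact Fintype.sum_equiv σ.symm _ _ fun i => by simp
    calc ∑ i, |(∑ σ : Equiv.Perm ι, p ((· ∘ σ.symm) ⁻¹' F) (σ.symm i) (v ∘ σ)) / N - bit (v i)|
        ≤ ∑ i, (∑ σ : Equiv.Perm ι,
            |p ((· ∘ σ.symm) ⁻¹' F) (σ.symm i) (v ∘ σ) - bit (v i)|) / N := by
          refine Finset.sum_le_sum fun i _ => ?_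
          rw [div_sub' hN0.ne', abs_div, abs_of_pos hN0, ← hNs, ← Finset.sum_sub_distrib]
          gcongr
          exact Finset.abs_sum_le_sum_abs _ _
      _ = (∑ σ : Equiv.Perm ι,
            ∑ i, |p ((· ∘ σ.symm) ⁻¹' F) (σ.symm i) (v ∘ σ) - bit (v i)|) / N := by
          rw [← Finset.sum_div, Finset.sum_comm]
      _ ≤ (∑ _σ : Equiv.Perm ι, (d : ℝ)) / N := by
          gcongr with σ
          exact h1 σ
      _ = d := by rw [hNs]; field_simp

/-! ### Patterns of a partial class on a tuple of instances. -/

/-- The binary patterns which `H` realizes on a tuple of instances. -/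
def patterns {X : Type*} (H : Set (PHyp X)) {k : ℕ} (x : Fin k → X) : Set (Fin k → Bool) :=
  {b | x ∈ patternSet H b}

theorem patterns_comp_perm {X : Type*} (H : Set (PHyp X)) {k : ℕ} (x : Fin k → X)
    (σ : Equiv.Perm (Fin k)) : patterns H (x ∘ σ) = (· ∘ σ.symm) ⁻¹' patterns H x := by
  ext b
  simp only [patterns, patternSet, Set.mem_ofPred_eq, Set.mem_preimage, Function.comp_apply]
  refine exists_congr fun h => and_congr_right fun _ => ?_
  refine ⟨fun hb i => by simpa using hb (σ.symm i), fun hb i => by simpa using hb (σ i)⟩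

theorem vcDimLE_patterns {X : Type*} {H : Set (PHyp X)} {d : ℕ} (hd : HasVCDim H d) {k : ℕ}
    (x : Fin k → X) : VCDimLE (patterns H x) d := by
  classical
  intro s hs
  -- A hypothesis gives equal instances equal labels, so a shattered set of coordinates contains no
  -- repeated instance.
  have hinj : Set.InjOn x s := by
    intro i hi j hj hij
    by_contra hne
    obtain ⟨v, ⟨h, -, hv⟩, hvb⟩ := hs (fun l => decide (l = i))
    have h1 : v i = true := by simp [hvb i hi]
    have h2 : v j = false := by simpa [Ne.symm hne] using hvb j hj
    have h3 := hv i
    rw [hij, hv j, h1, h2] at h3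
    simp at h3
  rw [← Finset.card_image_of_injOn hinj]
  refine hd.2 ⟨_, rfl, fun b => ?_⟩
  obtain ⟨v, ⟨h, hH, hv⟩, hvb⟩ := hs fun i => if hi : x i ∈ s.image x then b ⟨x i, hi⟩ else true
  refine ⟨h, hH, ?_⟩
  rintro ⟨y, hy⟩
  obtain ⟨i, hi, rfl⟩ := Finset.mem_image.1 hy
  rw [hv i, hvb i hi, dif_pos hy]

/-! ### Product measures and the forward supermartingale. -/

section Sampling

variable {Z : Type*} [MeasurableSpace Z] (P : Measure Z) [IsProbabilityMeasure P]

/-- Covers both restriction to a prefix and permutation of the sample; coordinates outside the range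
of `e` contribute mass one. -/
theorem measurePreserving_comp_injective {ι κ : Type*} [Fintype ι] [Fintype κ] (e : κ → ι)
    (he : Function.Injective e) :
    MeasurePreserving (fun z : ι → Z => z ∘ e) (Measure.pi fun _ => P)
      (Measure.pi fun _ => P) := by
  classical
  have hm : Measurable fun z : ι → Z => z ∘ e := by
    refine measurable_pi_lambda _ fun i => ?_
    exact measurable_pi_apply (e i)
  refine ⟨hm, (Measure.pi_eq fun s hs => ?_).symm⟩
  rw [Measure.map_apply hm (MeasurableSet.univ_pi hs)]
  have h1 : (fun z : ι → Z => z ∘ e) ⁻¹' Set.univ.pi s =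
      Set.univ.pi fun j => ⋂ i, ⋂ _ : e i = j, s i := by
    ext z
    simp only [Set.mem_preimage, Set.mem_univ_pi, Function.comp_apply, Set.mem_iInter]
    exact ⟨fun h j i hij => hij ▸ h i, fun h i => h (e i) i rfl⟩
  rw [h1, Measure.pi_pi]
  symm
  refine Fintype.prod_of_injective e he _ _ (fun j hj => ?_) fun i => ?_
  · have : (⋂ i, ⋂ _ : e i = j, s i) = Set.univ := by
      simp only [Set.iInter_eq_univ]
      exact fun i hi => absurd ⟨i, hi⟩ hj
    rw [this, measure_univ]
  · congr 1
    ext z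
    simp only [Set.mem_iInter]
    exact ⟨fun h j hj => he hj ▸ h, fun h => h i rfl⟩

theorem measurePreserving_snoc (n : ℕ) :
    MeasurePreserving (fun p : (Fin n → Z) × Z => (Fin.snoc p.1 p.2 : Fin (n + 1) → Z))
      ((Measure.pi fun _ => P).prod P) (Measure.pi fun _ => P) := by
  have h := ((measurePreserving_piFinSuccAbove (fun _ : Fin (n + 1) => P) (Fin.last n)).symm).comp
    (Measure.measurePreserving_swap (μ := Measure.pi fun _ : Fin n => P) (ν := P))
  convert h using 1
  funext p
  exact (Fin.insertNth_last' p.2 p.1).symm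

theorem lintegral_pi_snoc {n : ℕ} {f : (Fin (n + 1) → Z) → ENNReal} (hf : Measurable f) :
    ∫⁻ S, f S ∂(Measure.pi fun _ => P) =
      ∫⁻ w, ∫⁻ z, f (Fin.snoc w z) ∂P ∂(Measure.pi fun _ : Fin n => P) := by
  rw [← (measurePreserving_snoc P n).lintegral_comp hf]
  exact lintegral_prod _ (hf.comp (measurePreserving_snoc P n).measurable).aemeasurable

/-- The chord bound from convexity of `exp`. -/
theorem exp_mul_le_of_mem_Icc (η : ℝ) {x : ℝ} (hx : x ∈ Set.Icc (0 : ℝ) 1) :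
    Real.exp (η * x) ≤ 1 + (Real.exp η - 1) * x := by
  have h := convexOn_exp.2 (Set.mem_univ 0) (Set.mem_univ η) (sub_nonneg.2 hx.2) hx.1
    (sub_add_cancel 1 x)
  simp only [smul_eq_mul, mul_zero, zero_add, Real.exp_zero, mul_one] at h
  rw [mul_comm η x]
  linarith

/-- The conditional risk of the loss `l` on the next example, given the first `t` examples. -/
noncomputable def nextRisk {t : ℕ} (l : (Fin (t + 1) → Z) → ℝ) (w : Fin t → Z) : ℝ :=
  ∫ z, l (Fin.snoc w z) ∂P

theorem measurable_nextRisk {t : ℕ} {l : (Fin (t + 1) → Z) → ℝ} (hl : Measurable l) :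
    Measurable (nextRisk P l) :=
  ((hl.comp (measurePreserving_snoc P t).measurable).stronglyMeasurable.integral_prod_right').measurable

/-- The chord bound at `-η` gives the factor `1 - exp (-η)`; after integration, `1 - x ≤ exp (-x)`
cancels the risk term. -/
theorem lintegral_exp_nextRisk_sub_le {t : ℕ} {l : (Fin (t + 1) → Z) → ℝ} (hl : Measurable l)
    (hl01 : ∀ z, l z ∈ Set.Icc (0 : ℝ) 1) (η : ℝ) (w : Fin t → Z) :
    ∫⁻ z, ENNReal.ofReal
      (Real.exp ((1 - Real.exp (-η)) * nextRisk P l w - η * l (Fin.snoc w z))) ∂P ≤ 1 := by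
  set c := 1 - Real.exp (-η) with hc
  have hm : Measurable fun z => l (Fin.snoc w z) :=
    hl.comp ((measurePreserving_snoc P t).measurable.comp measurable_prodMk_left)
  have hint : Integrable (fun z => l (Fin.snoc w z)) P :=
    Integrable.of_bound hm.aestronglyMeasurable 1 (ae_of_all _ fun z => by
      rw [Real.norm_eq_abs, abs_of_nonneg (hl01 _).1]
      exact (hl01 _).2)
  have hi2 : Integrable (fun z => 1 - c * l (Fin.snoc w z)) P :=
    (integrable_const 1).sub (hint.const_mul c)
  have hb : ∀ z, Real.exp (-η * l (Fin.snoc w z)) ≤ 1 - c * l (Fin.snoc w z) := fun z => by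
    have := exp_mul_le_of_mem_Icc (-η) (hl01 (Fin.snoc w z))
    rw [hc]
    linarith
  calc _ = ∫⁻ z, ENNReal.ofReal (Real.exp (c * nextRisk P l w)) *
        ENNReal.ofReal (Real.exp (-η * l (Fin.snoc w z))) ∂P := by
        refine lintegral_congr fun z => ?_
        rw [← ENNReal.ofReal_mul (Real.exp_nonneg _), ← Real.exp_add]
        congr 2
        ring
    _ ≤ ∫⁻ z, ENNReal.ofReal (Real.exp (c * nextRisk P l w)) *
        ENNReal.ofReal (1 - c * l (Fin.snoc w z)) ∂P := by
        gcongr with z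
        exact hb z
    _ = ENNReal.ofReal (Real.exp (c * nextRisk P l w)) *
        ENNReal.ofReal (1 - c * nextRisk P l w) := by
        rw [lintegral_const_mul' _ _ ENNReal.ofReal_ne_top,
          ← ofReal_integral_eq_lintegral_ofReal hi2
            (ae_of_all _ fun z => (Real.exp_nonneg _).trans (hb z)),
          integral_sub (integrable_const 1) (hint.const_mul c), integral_const_mul]
        simp [nextRisk]
    _ ≤ ENNReal.ofReal (Real.exp (c * nextRisk P l w)) *
        ENNReal.ofReal (Real.exp (-(c * nextRisk P l w))) := by
        gcongr
        linarith [Real.add_one_le_exp (-(c * nextRisk P l w))]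
    _ = 1 := by
        rw [← ENNReal.ofReal_mul (Real.exp_nonneg _), ← Real.exp_add]
        simp

/-- The exponential supermartingale that compares conditional risks with observed losses. -/
theorem lintegral_prod_exp_nextRisk_sub_le {l : ∀ t, (Fin (t + 1) → Z) → ℝ}
    (hl : ∀ t, Measurable (l t)) (hl01 : ∀ t z, l t z ∈ Set.Icc (0 : ℝ) 1) (η : ℝ) (n : ℕ) :
    ∫⁻ S : Fin n → Z, ∏ t : Fin n, ENNReal.ofReal
      (Real.exp ((1 - Real.exp (-η)) * nextRisk P (l t) (S ∘ Fin.castLE t.2.le) -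
        η * l t (S ∘ Fin.castLE t.2))) ∂(Measure.pi fun _ => P) ≤ 1 := by
  have hmeas : ∀ n : ℕ, Measurable fun S : Fin n → Z => ∏ t : Fin n, ENNReal.ofReal
      (Real.exp ((1 - Real.exp (-η)) * nextRisk P (l t) (S ∘ Fin.castLE t.2.le) -
        η * l t (S ∘ Fin.castLE t.2))) := by
    intro n
    refine Finset.measurable_prod _ fun t _ => ENNReal.measurable_ofReal.comp
      (Real.measurable_exp.comp (Measurable.sub (Measurable.const_mul ?_ _)
        (Measurable.const_mul ?_ _)))
    · exact (measurable_nextRisk P (hl t)).comp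
        (measurePreserving_comp_injective P _ (Fin.castLE_injective _)).measurable
    · exact (hl t).comp
        (measurePreserving_comp_injective P _ (Fin.castLE_injective _)).measurable
  induction n with
  | zero => simp
  | succ n ih =>
    rw [lintegral_pi_snoc P (hmeas (n + 1))]
    refine le_trans (lintegral_mono fun w => ?_) ih
    have hr : ∀ (z : Z) (k : ℕ) (hk : k ≤ n) (hk' : k ≤ n + 1),
        (Fin.snoc w z : Fin (n + 1) → Z) ∘ Fin.castLE hk' = w ∘ Fin.castLE hk := by
      intro z k hk hk'
      funext i
      exact Fin.snoc_castSucc (α := fun _ => Z) z w (Fin.castLE hk i)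
    have hs : ∀ z : Z, (Fin.snoc w z : Fin (n + 1) → Z) ∘ Fin.castLE (Fin.last n).2 =
        Fin.snoc w z := fun z => rfl
    simp only [Fin.prod_univ_castSucc]
    calc _ = ∫⁻ z, (∏ t : Fin n, ENNReal.ofReal
          (Real.exp ((1 - Real.exp (-η)) * nextRisk P (l t) (w ∘ Fin.castLE t.2.le) -
            η * l t (w ∘ Fin.castLE t.2)))) * ENNReal.ofReal
          (Real.exp ((1 - Real.exp (-η)) * nextRisk P (l n) w - η * l n (Fin.snoc w z))) ∂P := by
          refine lintegral_congr fun z => ?_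
          congr 1
          · refine Finset.prod_congr rfl fun t _ => ?_
            have h1 := hr z t t.2.le t.castSucc.2.le
            have h2 := hr z (t + 1) t.2 t.castSucc.2
            simp only [Fin.val_castSucc] at h1 h2 ⊢
            rw [h1, h2]
          · have h1 := hr z n le_rfl (Fin.last n).2.le
            have h2 : w ∘ Fin.castLE (le_refl n) = w := rfl
            rw [h2] at h1
            simp only [Fin.val_last] at h1 ⊢
            rw [h1]
            rfl
      _ ≤ _ := by
          rw [lintegral_const_mul' _ _ (ENNReal.prod_ne_top fun _ _ => ENNReal.ofReal_ne_top)]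
          calc _ ≤ _ * (1 : ENNReal) := by
                gcongr
                exact lintegral_exp_nextRisk_sub_le P (hl n) (hl01 n) η w
            _ = _ := mul_one _

end Sampling

theorem swap_castLE_comp {Z : Type*} {k n : ℕ} (h : k ≤ n) (i j : Fin k) (S : Fin n → Z) :
    (S ∘ Equiv.swap (Fin.castLE h i) (Fin.castLE h j)) ∘ Fin.castLE h =
      (S ∘ Fin.castLE h) ∘ Equiv.swap i j := by
  funext x
  simp only [Function.comp_apply]
  rw [(Fin.castLE_injective h).map_swap]

/-! ### Exponential moments from exchangeability. -/

section Exchangeable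

variable {Z : Type*} [MeasurableSpace Z] (P : Measure Z) [IsProbabilityMeasure P]

/-- Since `W` is invariant under the swaps, the last loss may be averaged over which of the first `s
+ 1` examples comes last; the chord bound then brings in the leave-one-out sum. -/
theorem lintegral_exp_mul_le {s n : ℕ} (hs : s < n) {l : (Fin (s + 1) → Z) → ℝ}
    (hl : AEMeasurable l (Measure.pi fun _ => P)) (hl01 : ∀ z, l z ∈ Set.Icc (0 : ℝ) 1)
    {B : ℝ} (hB : ∀ᵐ z ∂(Measure.pi fun _ : Fin (s + 1) => P),
      ∑ i, l (z ∘ Equiv.swap i (Fin.last s)) ≤ B)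
    {η : ℝ} (hη : 0 ≤ η) {W : (Fin n → Z) → ENNReal} (hW : AEMeasurable W (Measure.pi fun _ => P))
    (hWs : ∀ i j : Fin (s + 1), ∀ S, W (S ∘ Equiv.swap (Fin.castLE hs i) (Fin.castLE hs j)) = W S) :
    ∫⁻ S, ENNReal.ofReal (Real.exp (η * l (S ∘ Fin.castLE hs))) * W S ∂(Measure.pi fun _ => P) ≤
      ENNReal.ofReal (1 + (Real.exp η - 1) * B / (s + 1)) * ∫⁻ S, W S ∂(Measure.pi fun _ => P) := by
  set a := Real.exp η - 1 with ha
  have ha0 : 0 ≤ a := by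
    have := Real.one_le_exp hη
    linarith
  have hres := measurePreserving_comp_injective P (Fin.castLE hs) (Fin.castLE_injective hs)
  have hsw : ∀ i j : Fin n, MeasurePreserving (fun S : Fin n → Z => S ∘ Equiv.swap i j)
      (Measure.pi fun _ => P) (Measure.pi fun _ => P) := fun i j =>
    measurePreserving_comp_injective P _ (Equiv.injective _)
  have hf : AEMeasurable (fun S : Fin n → Z =>
      ENNReal.ofReal (Real.exp (η * l (S ∘ Fin.castLE hs)))) (Measure.pi fun _ => P) := by
    refine (Real.measurable_exp.comp_aemeasurable (AEMeasurable.const_mul ?_ η)).ennreal_ofReal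
    exact hl.comp_quasiMeasurePreserving hres.quasiMeasurePreserving
  have h1 : ∀ i : Fin (s + 1),
      ∫⁻ S, ENNReal.ofReal (Real.exp (η * l (S ∘ Fin.castLE hs))) * W S ∂(Measure.pi fun _ => P) =
      ∫⁻ S, ENNReal.ofReal
        (Real.exp (η * l ((S ∘ Fin.castLE hs) ∘ Equiv.swap i (Fin.last s)))) * W S
          ∂(Measure.pi fun _ => P) := by
    intro i
    have hT := hsw (Fin.castLE hs i) (Fin.castLE hs (Fin.last s))
    have hm : AEMeasurable (fun S => ENNReal.ofReal (Real.exp (η * l (S ∘ Fin.castLE hs))) * W S)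
        ((Measure.pi fun _ : Fin n => P).map fun S : Fin n → Z =>
          S ∘ Equiv.swap (Fin.castLE hs i) (Fin.castLE hs (Fin.last s))) := by
      rw [hT.map_eq]
      exact hf.mul hW
    conv_lhs => rw [← hT.map_eq]
    rw [lintegral_map' hm hT.measurable.aemeasurable]
    refine lintegral_congr fun S => ?_
    rw [swap_castLE_comp, hWs]
  have h2 : ∀ᵐ S ∂(Measure.pi fun _ : Fin n => P),
      ∑ i, ENNReal.ofReal
        (Real.exp (η * l ((S ∘ Fin.castLE hs) ∘ Equiv.swap i (Fin.last s)))) ≤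
      ENNReal.ofReal ((s + 1) + a * B) := by
    filter_upwards [hres.quasiMeasurePreserving.ae hB] with S hS
    rw [← ENNReal.ofReal_sum_of_nonneg fun i _ => Real.exp_nonneg _]
    refine ENNReal.ofReal_le_ofReal ?_
    calc _ ≤ ∑ i : Fin (s + 1), (1 + a * l ((S ∘ Fin.castLE hs) ∘ Equiv.swap i (Fin.last s))) :=
          Finset.sum_le_sum fun i _ => exp_mul_le_of_mem_Icc η (hl01 _)
      _ = (s + 1) + a * ∑ i, l ((S ∘ Fin.castLE hs) ∘ Equiv.swap i (Fin.last s)) := by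
          rw [Finset.sum_add_distrib, ← Finset.mul_sum]
          simp
      _ ≤ _ := by gcongr
  have h3 : ((s + 1 : ℕ) : ENNReal) *
      ∫⁻ S, ENNReal.ofReal (Real.exp (η * l (S ∘ Fin.castLE hs))) * W S ∂(Measure.pi fun _ => P) ≤
      ENNReal.ofReal ((s + 1) + a * B) * ∫⁻ S, W S ∂(Measure.pi fun _ => P) := by
    calc _ = ∑ i : Fin (s + 1), ∫⁻ S, ENNReal.ofReal
            (Real.exp (η * l ((S ∘ Fin.castLE hs) ∘ Equiv.swap i (Fin.last s)))) * W S
          ∂(Measure.pi fun _ => P) := by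
          rw [← Finset.sum_congr rfl fun i _ => h1 i]
          simp
      _ = ∫⁻ S, (∑ i : Fin (s + 1), ENNReal.ofReal
            (Real.exp (η * l ((S ∘ Fin.castLE hs) ∘ Equiv.swap i (Fin.last s))))) * W S
          ∂(Measure.pi fun _ => P) := by
          simp only [Finset.sum_mul]
          refine (lintegral_finsetSum' _ fun i _ => ?_).symm
          refine AEMeasurable.mul ?_ hW
          have := hf.comp_quasiMeasurePreserving
            (hsw (Fin.castLE hs i) (Fin.castLE hs (Fin.last s))).quasiMeasurePreserving
          refine this.congr (ae_of_all _ fun S => ?_)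
          simp only [Function.comp_def]
          congr 4
          exact swap_castLE_comp hs i (Fin.last s) S
      _ ≤ ∫⁻ S, ENNReal.ofReal ((s + 1) + a * B) * W S ∂(Measure.pi fun _ => P) := by
          refine lintegral_mono_ae ?_
          filter_upwards [h2] with S hS
          gcongr
      _ = _ := lintegral_const_mul' _ _ ENNReal.ofReal_ne_top
  have hs0 : (0 : ℝ) < (s : ℝ) + 1 := by positivity
  have h4 : ENNReal.ofReal ((s + 1) + a * B) =
      ((s + 1 : ℕ) : ENNReal) * ENNReal.ofReal (1 + a * B / (s + 1)) := by
    rw [← ENNReal.ofReal_natCast, ← ENNReal.ofReal_mul (by positivity)]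
    congr 1
    push_cast
    field_simp
  rw [h4, mul_assoc] at h3
  exact (ENNReal.mul_le_mul_iff_right (by simp) (ENNReal.natCast_ne_top _)).1 h3

/-- For losses that are symmetric in the training examples, an exponential moment bound for the
observed losses follows from bounds for the leave-one-out sums. -/
theorem lintegral_prod_exp_le {l : ∀ t, (Fin (t + 1) → Z) → ℝ} {n : ℕ}
    (hl : ∀ t, AEMeasurable (l t) (Measure.pi fun _ => P))
    (hl01 : ∀ t z, l t z ∈ Set.Icc (0 : ℝ) 1)
    (hsymm : ∀ t (σ : Equiv.Perm (Fin (t + 1))), σ (Fin.last t) = Fin.last t →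
      ∀ z, l t (z ∘ σ) = l t z)
    {B : ℕ → ℝ} (hB : ∀ t, ∀ᵐ z ∂(Measure.pi fun _ : Fin (t + 1) => P),
      ∑ i, l t (z ∘ Equiv.swap i (Fin.last t)) ≤ B t)
    {η : ℝ} (hη : 0 ≤ η) :
    ∫⁻ S : Fin n → Z, ∏ t : Fin n, ENNReal.ofReal (Real.exp (η * l t (S ∘ Fin.castLE t.2)))
        ∂(Measure.pi fun _ => P) ≤
      ∏ t : Fin n, ENNReal.ofReal (1 + (Real.exp η - 1) * B t / (t + 1)) := by
  have key : ∀ s ≤ n, ∫⁻ S : Fin n → Z, ∏ t : Fin n with s ≤ t.1,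
        ENNReal.ofReal (Real.exp (η * l t (S ∘ Fin.castLE t.2))) ∂(Measure.pi fun _ => P) ≤
      ∏ t : Fin n with s ≤ t.1, ENNReal.ofReal (1 + (Real.exp η - 1) * B t / (t + 1)) := by
    intro s hs
    induction hs using Nat.decreasingInduction with
    | self =>
      have : (Finset.univ.filter fun t : Fin n => n ≤ t.1) = ∅ := by
        ext t
        simp
      simp [this]
    | of_succ s hs ih =>
      have h1 : (Finset.univ.filter fun t : Fin n => s ≤ t.1) =
          insert ⟨s, hs⟩ (Finset.univ.filter fun t : Fin n => s + 1 ≤ t.1) := by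
        ext t
        simp only [Finset.mem_filter, Finset.mem_univ, true_and, Finset.mem_insert, Fin.ext_iff]
        omega
      rw [h1, Finset.prod_insert (by simp)]
      simp only [Finset.prod_insert (show (⟨s, hs⟩ : Fin n) ∉
        (Finset.univ.filter fun t : Fin n => s + 1 ≤ t.1) by simp)]
      refine le_trans (lintegral_exp_mul_le P hs (hl s) (hl01 s) (hB s) hη ?_ ?_)
        (mul_le_mul_right ih _)
      · refine Finset.aemeasurable_fun_prod _ fun t _ => ?_
        refine (Real.measurable_exp.comp_aemeasurable (AEMeasurable.const_mul ?_ η)).ennreal_ofReal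
        exact (hl t).comp_quasiMeasurePreserving
          (measurePreserving_comp_injective P _ (Fin.castLE_injective _)).quasiMeasurePreserving
      -- A later loss has its test point at position `t > s`, which swaps among the first `s + 1`
      -- positions leave fixed.
      · intro i j S
        refine Finset.prod_congr rfl fun t ht => ?_
        have hst : s + 1 ≤ t.1 := (Finset.mem_filter.1 ht).2
        have hst' : s + 1 ≤ t.1 + 1 := by omega
        have h2 : ∀ i, Fin.castLE hs i = Fin.castLE t.2 (Fin.castLE hst' i) := fun i => rfl
        rw [h2 i, h2 j, swap_castLE_comp, hsymm]
        refine Equiv.swap_apply_of_ne_of_ne ?_ ?_ <;>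
        · rw [Ne, Fin.ext_iff]
          simp only [Fin.val_last, Fin.val_castLE]
          omega
  simpa using key 0 (Nat.zero_le n)

end Exchangeable

/-! ### Online-to-batch conversion. -/

theorem two_mul_exp_half_le (x y : ℝ) :
    2 * Real.exp ((x + y) / 2) ≤ Real.exp x + Real.exp y := by
  have h1 : Real.exp ((x + y) / 2) = Real.exp (x / 2) * Real.exp (y / 2) := by
    rw [← Real.exp_add]
    congr 1
    ring
  have h2 : ∀ u : ℝ, Real.exp u = Real.exp (u / 2) ^ 2 := fun u => by
    rw [← Real.exp_nat_mul]
    congr 1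
    push_cast
    ring
  rw [h1, h2 x, h2 y]
  linarith [two_mul_le_add_sq (Real.exp (x / 2)) (Real.exp (y / 2))]

/-- Online-to-batch conversion in the exchangeable setting: with high probability the sum of the
conditional risks is controlled by the leave-one-out bounds. -/
theorem measure_sum_nextRisk_gt_le {Z : Type*} [MeasurableSpace Z] (P : Measure Z)
    [IsProbabilityMeasure P] {l l' : ∀ t, (Fin (t + 1) → Z) → ℝ} {n : ℕ}
    (hl : ∀ t, l t =ᵐ[Measure.pi fun _ => P] l' t) (hl' : ∀ t, Measurable (l' t))
    (hl01 : ∀ t z, l t z ∈ Set.Icc (0 : ℝ) 1) (hl01' : ∀ t z, l' t z ∈ Set.Icc (0 : ℝ) 1)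
    (hsymm : ∀ t (σ : Equiv.Perm (Fin (t + 1))), σ (Fin.last t) = Fin.last t →
      ∀ z, l t (z ∘ σ) = l t z)
    {B : ℕ → ℝ} (hB0 : ∀ t, 0 ≤ B t) (hB : ∀ t, ∀ᵐ z ∂(Measure.pi fun _ : Fin (t + 1) => P),
      ∑ i, l t (z ∘ Equiv.swap i (Fin.last t)) ≤ B t)
    {η δ : ℝ} (hη : 0 ≤ η) (hδ : 0 < δ) :
    (Measure.pi fun _ : Fin n => P)
      {S | ∑ t : Fin n, Real.log (1 + (Real.exp η - 1) * B t / (t + 1)) + 2 * Real.log (1 / δ) <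
        (1 - Real.exp (-η)) * ∑ t : Fin n, nextRisk P (l' t) (S ∘ Fin.castLE t.2.le)} ≤
      ENNReal.ofReal δ := by
  have ha0 : 0 ≤ Real.exp η - 1 := by
    have := Real.one_le_exp hη
    linarith
  set c := 1 - Real.exp (-η) with hc
  have hK1 : ∀ t : Fin n, 0 < 1 + (Real.exp η - 1) * B t / (t + 1) := fun t => by
    have := hB0 t
    positivity
  set κ := ∑ t : Fin n, Real.log (1 + (Real.exp η - 1) * B t / (t + 1)) with hκ
  have hexpκ : ENNReal.ofReal (Real.exp κ) =
      ∏ t : Fin n, ENNReal.ofReal (1 + (Real.exp η - 1) * B t / (t + 1)) := by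
    rw [hκ, Real.exp_sum, ENNReal.ofReal_prod_of_nonneg fun _ _ => Real.exp_nonneg _]
    exact Finset.prod_congr rfl fun t _ => by rw [Real.exp_log (hK1 t)]
  have hres : ∀ (t : ℕ) (h : t ≤ n), MeasurePreserving (fun S : Fin n → Z => S ∘ Fin.castLE h)
      (Measure.pi fun _ => P) (Measure.pi fun _ => P) := fun t h =>
    measurePreserving_comp_injective P _ (Fin.castLE_injective h)
  let A : (Fin n → Z) → ℝ := fun S => c * ∑ t : Fin n, nextRisk P (l' t) (S ∘ Fin.castLE t.2.le)
  -- The loss `l` is symmetric but only a.e. measurable; its version `l'` is measurable but perhaps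
  -- not symmetric. Exchangeability uses `l`, the supermartingale `l'`.
  let L : (Fin n → Z) → ℝ := fun S => η * ∑ t : Fin n, l t (S ∘ Fin.castLE t.2)
  let L' : (Fin n → Z) → ℝ := fun S => η * ∑ t : Fin n, l' t (S ∘ Fin.castLE t.2)
  have hA : Measurable A := (Finset.measurable_sum _ fun (t : Fin n) _ =>
    (measurable_nextRisk P (hl' t)).comp (hres t t.2.le).measurable).const_mul c
  have hL' : Measurable L' := (Finset.measurable_sum _ fun (t : Fin n) _ =>
    (hl' t).comp (hres (t + 1) t.2).measurable).const_mul η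
  have hLL' : ∀ᵐ S ∂(Measure.pi fun _ : Fin n => P), L S = L' S := by
    have : ∀ᵐ S ∂(Measure.pi fun _ : Fin n => P), ∀ t : Fin n,
        l t (S ∘ Fin.castLE t.2) = l' t (S ∘ Fin.castLE t.2) :=
      ae_all_iff.2 fun t => (hres (t + 1) t.2).quasiMeasurePreserving.ae (hl t)
    filter_upwards [this] with S hS
    simp only [L, L', hS]
  have hU : ∫⁻ S, ENNReal.ofReal (Real.exp (A S - L' S)) ∂(Measure.pi fun _ : Fin n => P) ≤ 1 := by
    refine le_trans (le_of_eq (lintegral_congr fun S => ?_))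
      (lintegral_prod_exp_nextRisk_sub_le P hl' hl01' η n)
    rw [← ENNReal.ofReal_prod_of_nonneg fun _ _ => Real.exp_nonneg _, ← Real.exp_sum,
      Finset.sum_sub_distrib, ← Finset.mul_sum, ← Finset.mul_sum]
  have hV : ∫⁻ S, ENNReal.ofReal (Real.exp (L' S - κ)) ∂(Measure.pi fun _ : Fin n => P) ≤ 1 := by
    have h1 := lintegral_prod_exp_le P (n := n) (fun t => ⟨l' t, hl' t, hl t⟩) hl01 hsymm hB hη
    rw [← hexpκ] at h1
    calc _ = ∫⁻ S, ENNReal.ofReal (Real.exp (-κ)) * ∏ t : Fin n,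
              ENNReal.ofReal (Real.exp (η * l t (S ∘ Fin.castLE t.2)))
                ∂(Measure.pi fun _ : Fin n => P) := by
          refine lintegral_congr_ae ?_
          filter_upwards [hLL'] with S hS
          rw [← hS, ← ENNReal.ofReal_prod_of_nonneg fun _ _ => Real.exp_nonneg _, ← Real.exp_sum,
            ← ENNReal.ofReal_mul (Real.exp_nonneg _), ← Real.exp_add, ← Finset.mul_sum]
          congr 2
          simp only [L]
          ring
      _ ≤ ENNReal.ofReal (Real.exp (-κ)) * ENNReal.ofReal (Real.exp κ) := by
          rw [lintegral_const_mul' _ _ ENNReal.ofReal_ne_top]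
          gcongr
      _ = 1 := by
          rw [← ENNReal.ofReal_mul (Real.exp_nonneg _), ← Real.exp_add]
          simp
  have hmU : Measurable fun S => ENNReal.ofReal (Real.exp (A S - L' S)) :=
    (Real.measurable_exp.comp (hA.sub hL')).ennreal_ofReal
  have hmV : Measurable fun S => ENNReal.ofReal (Real.exp (L' S - κ)) :=
    (Real.measurable_exp.comp (hL'.sub_const κ)).ennreal_ofReal
  -- On the bad event the two exponents add up to more than `2 * log (1 / δ)`, so the exponentials
  -- sum to at least `2 / δ`, while their integrals sum to at most `2`. No independence is needed.
  calc _ ≤ (Measure.pi fun _ : Fin n => P) {S | ENNReal.ofReal (2 / δ) ≤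
        ENNReal.ofReal (Real.exp (A S - L' S)) + ENNReal.ofReal (Real.exp (L' S - κ))} := by
        refine measure_mono fun S hS => ?_
        have hS' : κ + 2 * Real.log (1 / δ) < A S := hS
        change ENNReal.ofReal (2 / δ) ≤ _
        rw [← ENNReal.ofReal_add (Real.exp_nonneg _) (Real.exp_nonneg _)]
        refine ENNReal.ofReal_le_ofReal (le_trans ?_ (two_mul_exp_half_le _ _))
        have h1 : Real.exp (Real.log (1 / δ)) ≤ Real.exp ((A S - L' S + (L' S - κ)) / 2) :=
          Real.exp_le_exp.2 (by linarith)
        rw [Real.exp_log (by positivity)] at h1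
        calc 2 / δ = 2 * (1 / δ) := by ring
          _ ≤ _ := by gcongr
    _ ≤ (∫⁻ S, (ENNReal.ofReal (Real.exp (A S - L' S)) + ENNReal.ofReal (Real.exp (L' S - κ)))
          ∂(Measure.pi fun _ : Fin n => P)) / ENNReal.ofReal (2 / δ) :=
        meas_ge_le_lintegral_div (hmU.add hmV).aemeasurable (by simpa using hδ)
          ENNReal.ofReal_ne_top
    _ ≤ (1 + 1) / ENNReal.ofReal (2 / δ) := by
        rw [lintegral_add_left hmU]
        gcongr
    _ = ENNReal.ofReal δ := by
        have h2 : (1 + 1 : ENNReal) = ENNReal.ofReal 2 := by norm_num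
        rw [h2, ← ENNReal.ofReal_div_of_pos (by positivity)]
        congr 1
        field_simp

/-! ### The harmonic sum over the last three quarters. -/

theorem sum_Ico_inv_le_log {m n : ℕ} (hm : 0 < m) (hmn : m ≤ n) :
    ∑ t ∈ Finset.Ico m n, (1 : ℝ) / (t + 1) ≤ Real.log (n / m) := by
  induction n, hmn using Nat.le_induction with
  | base => simp [hm.ne']
  | succ n hmn ih =>
    have hn : (0 : ℝ) < n := by exact_mod_cast hm.trans_le hmn
    have hm' : (0 : ℝ) < m := by exact_mod_cast hm
    rw [Finset.sum_Ico_succ_top hmn]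
    have h1 := Real.log_le_sub_one_of_pos (x := n / (n + 1)) (by positivity)
    rw [Real.log_div hn.ne' (by positivity)] at h1
    rw [Real.log_div hn.ne' hm'.ne'] at ih
    have h2 : (n : ℝ) / (n + 1) - 1 = -(1 / (n + 1)) := by
      field_simp
      ring
    push_cast
    rw [Real.log_div (by positivity) hm'.ne']
    linarith

theorem sum_Ico_quarter_inv_le {n : ℕ} (hn : 17 ≤ n) :
    ∑ t ∈ Finset.Ico (n / 4) n, (1 : ℝ) / (t + 1) ≤ 8 / 5 := by
  have hm : 4 ≤ n / 4 := by omega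
  refine (sum_Ico_inv_le_log (by omega) (by omega)).trans ?_
  have hm' : (4 : ℝ) ≤ (n / 4 : ℕ) := by exact_mod_cast hm
  have hnm : (n : ℝ) ≤ 4 * (n / 4 : ℕ) + 3 := by
    have : n ≤ 4 * (n / 4) + 3 := by omega
    exact_mod_cast this
  -- The rounding remainder is at most `3` and the quotient at least `4`, so the ratio is at most `4
  -- + 3 / 4`.
  have h1 : (n : ℝ) / (n / 4 : ℕ) ≤ 19 / 4 := by
    rw [div_le_iff₀ (by linarith)]
    linarith
  have h0 : (0 : ℝ) < (n : ℝ) / (n / 4 : ℕ) := by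
    have : (17 : ℝ) ≤ n := by exact_mod_cast hn
    apply div_pos <;> linarith
  refine (Real.log_le_log h0 h1).trans ?_
  have h2 : (5 : ℕ) * Real.log (19 / 4) ≤ 8 := by
    rw [← Real.log_pow, Real.log_le_iff_le_exp (by positivity)]
    have h3 : Real.exp 8 = Real.exp 1 ^ 8 := by
      rw [← Real.exp_nat_mul]
      norm_num
    rw [h3]
    calc ((19 : ℝ) / 4) ^ 5 ≤ 2.718 ^ 8 := by norm_num
      _ ≤ _ := by
        gcongr
        linarith [Real.exp_one_gt_d9]
  push_cast at h2
  linarith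

/-! ### Measurability, losses and the majority vote. -/

theorem bit_mem_Icc (b : Bool) : bit b ∈ Set.Icc (0 : ℝ) 1 := by
  cases b <;> simp [bit]

/-- The value depends on the instances only through the finitely many pattern events, so an
arbitrary `φ` on this finite data is allowed. -/
theorem aemeasurable_of_patterns {X : Type*} [MeasurableSpace X] {H : Set (PHyp X)}
    {P : Measure (X × Bool)} [IsProbabilityMeasure P] (hP : PatternMeasurable H P) {k : ℕ}
    (φ : Set (Fin k → Bool) → (Fin k → Bool) → ℝ) :
    AEMeasurable (fun z : Fin k → X × Bool => φ (patterns H (Prod.fst ∘ z)) (Prod.snd ∘ z))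
      (Measure.pi fun _ => P) := by
  have : IsProbabilityMeasure (P.map Prod.fst) :=
    Measure.isProbabilityMeasure_map measurable_fst.aemeasurable
  have hfst : MeasurePreserving (fun z : Fin k → X × Bool => Prod.fst ∘ z)
      (Measure.pi fun _ => P) (Measure.pi fun _ => P.map Prod.fst) :=
    measurePreserving_pi _ _ fun _ => ⟨measurable_fst, rfl⟩
  have h1 : AEMeasurable (fun (z : Fin k → X × Bool) (b : Fin k → Bool) =>
      Prod.fst ∘ z ∈ patternSet H b) (Measure.pi fun _ => P) := by
    refine aemeasurable_pi_iff.2 fun b => ?_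
    obtain ⟨t, ht, hte⟩ := (hP k b).preimage hfst.quasiMeasurePreserving
    refine ⟨fun z => z ∈ t, measurableSet_setOfPred.1 ht, ?_⟩
    filter_upwards [Filter.eventuallyEq_set.1 hte] with z hz
    exact propext hz
  have h2 : Measurable fun z : Fin k → X × Bool => Prod.snd ∘ z :=
    measurable_pi_lambda _ fun i => measurable_snd.comp (measurable_pi_apply i)
  have h3 : Measurable fun q : ((Fin k → Bool) → Prop) × (Fin k → Bool) =>
      φ {b | q.1 b} q.2 := measurable_of_countable _
  exact h3.comp_aemeasurable (h1.prodMk h2.aemeasurable)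

theorem ae_mem_patterns {X : Type*} [MeasurableSpace X] {H : Set (PHyp X)}
    {P : Measure (X × Bool)} [IsProbabilityMeasure P] (hP : Realizable H P) (k : ℕ) :
    ∀ᵐ z ∂(Measure.pi fun _ : Fin k => P), Prod.snd ∘ z ∈ patterns H (Prod.fst ∘ z) := by
  obtain ⟨h, hH, herr⟩ := hP
  have h1 : ∀ᵐ z ∂P, h z.1 = some z.2 := by
    rw [ae_iff]
    exact (measureReal_eq_zero_iff).1 herr
  have h2 : ∀ᵐ z ∂(Measure.pi fun _ : Fin k => P), ∀ i, h (z i).1 = some (z i).2 :=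
    ae_all_iff.2 fun i =>
    (Measure.tendsto_eval_ae_ae (μ := fun _ : Fin k => P) (i := i)).eventually h1
  filter_upwards [h2] with z hz
  exact ⟨h, hH, hz⟩

/-- The leave-one-out loss of the prediction rule `p` on the last example. -/
noncomputable def lastLoss {X : Type*} (H : Set (PHyp X))
    (p : (k : ℕ) → Set (Fin k → Bool) → Fin k → (Fin k → Bool) → ℝ) (t : ℕ)
    (z : Fin (t + 1) → X × Bool) : ℝ :=
  |p (t + 1) (patterns H (Prod.fst ∘ z)) (Fin.last t) (Prod.snd ∘ z) - bit (z (Fin.last t)).2|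

/-- The fractional label predicted by `p` at `x` after training on `w`. -/
noncomputable def fracLabel {X : Type*} (H : Set (PHyp X))
    (p : (k : ℕ) → Set (Fin k → Bool) → Fin k → (Fin k → Bool) → ℝ) (t : ℕ)
    (w : Fin t → X × Bool) (x : X) : ℝ :=
  p (t + 1) (patterns H (Fin.snoc (Prod.fst ∘ w) x)) (Fin.last t) (Fin.snoc (Prod.snd ∘ w) false)

/-- The placeholder label in `fracLabel` is harmless, because the prediction ignores its own
coordinate. -/
theorem lastLoss_snoc {X : Type*} (H : Set (PHyp X))
    {p : (k : ℕ) → Set (Fin k → Bool) → Fin k → (Fin k → Bool) → ℝ}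
    (hpu : ∀ k F i v b, p k F i (Function.update v i b) = p k F i v) (t : ℕ)
    (w : Fin t → X × Bool) (z : X × Bool) :
    lastLoss H p t (Fin.snoc w z) = |fracLabel H p t w z.1 - bit z.2| := by
  have h1 : Prod.fst ∘ (Fin.snoc w z : Fin (t + 1) → X × Bool) = Fin.snoc (Prod.fst ∘ w) z.1 :=
    Fin.comp_snoc _ _ _
  have h2 : Prod.snd ∘ (Fin.snoc w z : Fin (t + 1) → X × Bool) =
      Function.update (Fin.snoc (Prod.snd ∘ w) false) (Fin.last t) z.2 := by
    rw [Fin.update_snoc_last]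
    exact Fin.comp_snoc _ _ _
  rw [lastLoss, fracLabel, h1, h2, hpu, Fin.snoc_last]

open Classical in
/-- The majority vote over the fractional predictions trained on the prefixes of the sample of
length at least `n / 4`. -/
noncomputable def majorityPredictor {X : Type*} (H : Set (PHyp X))
    (p : (k : ℕ) → Set (Fin k → Bool) → Fin k → (Fin k → Bool) → ℝ) : Predictor X :=
  fun n S x => some (decide (((n : ℝ) - (n / 4 : ℕ)) / 2 ≤
    ∑ t : Fin n, if n / 4 ≤ t.1 then fracLabel H p t (S ∘ Fin.castLE t.2.le) x else 0))

theorem sum_ite_one (n m : ℕ) (h : m ≤ n) :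
    ∑ t : Fin n, (if m ≤ t.1 then (1 : ℝ) else 0) = (n : ℝ) - m := by
  rw [Fin.sum_univ_eq_sum_range (fun t => if m ≤ t then (1 : ℝ) else 0), ← Finset.sum_filter]
  have : (Finset.range n).filter (m ≤ ·) = Finset.Ico m n := by
    ext
    simp [and_comm]
  simp [this, Nat.cast_sub h]

/-- Ties are voted `true`; the threshold is half the number of voters, so the bound holds for either
label. -/
theorem le_sum_loss_of_majorityPredictor_ne {X : Type*} {H : Set (PHyp X)}
    {p : (k : ℕ) → Set (Fin k → Bool) → Fin k → (Fin k → Bool) → ℝ}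
    {n : ℕ} {S : Fin n → X × Bool} {z : X × Bool}
    (hz : majorityPredictor H p n S z.1 ≠ some z.2) :
    ((n : ℝ) - (n / 4 : ℕ)) / 2 ≤ ∑ t : Fin n,
      if n / 4 ≤ t.1 then |fracLabel H p t (S ∘ Fin.castLE t.2.le) z.1 - bit z.2| else 0 := by
  obtain ⟨x, y⟩ := z
  simp only [majorityPredictor, ne_eq, Option.some.injEq] at hz ⊢
  cases y
  · simp only [decide_eq_false_iff_not, not_not] at hz
    refine hz.trans (Finset.sum_le_sum fun t _ => ?_)
    split_ifs
    · simpa [bit] using le_abs_self (fracLabel H p t (S ∘ Fin.castLE t.2.le) x)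
    · exact le_rfl
  · simp only [decide_eq_true_eq, not_le] at hz
    have h1 := sum_ite_one n (n / 4) (Nat.div_le_self n 4)
    have h2 : (∑ t : Fin n, if n / 4 ≤ t.1 then (1 : ℝ) else 0) -
        ∑ t : Fin n, (if n / 4 ≤ t.1 then fracLabel H p t (S ∘ Fin.castLE t.2.le) x else 0) ≤
        ∑ t : Fin n,
          if n / 4 ≤ t.1 then |fracLabel H p t (S ∘ Fin.castLE t.2.le) x - bit true| else 0 := by
      rw [← Finset.sum_sub_distrib]
      refine Finset.sum_le_sum fun t _ => ?_
      split_ifs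
      · rw [abs_sub_comm]
        simpa [bit] using le_abs_self (1 - fracLabel H p t (S ∘ Fin.castLE t.2.le) x)
      · simp
    linarith

/-- Markov's inequality for the total loss. The error event enters through its outer measure, so the
vote need not be measurable. -/
theorem err_majorityPredictor_le {X : Type*} [MeasurableSpace X] {H : Set (PHyp X)}
    {P : Measure (X × Bool)} [IsProbabilityMeasure P]
    {p : (k : ℕ) → Set (Fin k → Bool) → Fin k → (Fin k → Bool) → ℝ}
    {n : ℕ} {S : Fin n → X × Bool}
    {l' : ∀ t, (Fin (t + 1) → X × Bool) → ℝ} (hl' : ∀ t, Measurable (l' t))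
    (hl01' : ∀ t z, l' t z ∈ Set.Icc (0 : ℝ) 1)
    (h : ∀ t : Fin n, ∀ᵐ z ∂P, (if n / 4 ≤ t.1 then
      |fracLabel H p t (S ∘ Fin.castLE t.2.le) z.1 - bit z.2| else 0) =
        l' t (Fin.snoc (S ∘ Fin.castLE t.2.le) z)) :
    ((n : ℝ) - (n / 4 : ℕ)) / 2 * err (majorityPredictor H p n S) P ≤
      ∑ t : Fin n, nextRisk P (l' t) (S ∘ Fin.castLE t.2.le) := by
  have hint : ∀ t : Fin n,
      Integrable (fun z => l' t (Fin.snoc (S ∘ Fin.castLE t.2.le) z)) P := fun t => by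
    refine Integrable.of_bound ?_ 1 (ae_of_all _ fun z => by
      rw [Real.norm_eq_abs, abs_of_nonneg (hl01' _ _).1]
      exact (hl01' _ _).2)
    have hm : Measurable fun z => l' t (Fin.snoc (S ∘ Fin.castLE t.2.le) z) :=
      (hl' t).comp ((measurePreserving_snoc P t).measurable.comp
        (measurable_prodMk_left (x := S ∘ Fin.castLE t.2.le)))
    exact hm.aestronglyMeasurable
  have hn : (0 : ℝ) ≤ ((n : ℝ) - (n / 4 : ℕ)) / 2 := by
    have : ((n / 4 : ℕ) : ℝ) ≤ n := by exact_mod_cast Nat.div_le_self n 4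
    linarith
  have h1 := mul_meas_ge_le_integral_of_nonneg (μ := P)
    (f := fun z => ∑ t : Fin n, l' t (Fin.snoc (S ∘ Fin.castLE t.2.le) z))
    (ae_of_all _ fun z => Finset.sum_nonneg fun t _ => (hl01' _ _).1)
    (integrable_finsetSum _ fun t _ => hint t) (((n : ℝ) - (n / 4 : ℕ)) / 2)
  rw [integral_finsetSum _ fun t _ => hint t] at h1
  refine le_trans (mul_le_mul_of_nonneg_left ?_ hn) h1
  refine ENNReal.toReal_mono (measure_ne_top _ _) (measure_mono_ae ?_)
  filter_upwards [ae_all_iff.2 h] with z hz hne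
  have h2 := le_sum_loss_of_majorityPredictor_ne hne
  rw [Finset.sum_congr rfl fun t _ => hz t] at h2
  exact h2

/-! ### Numerical constants and the conclusion. -/

theorem risk_bound_of_sum_le {d n : ℕ} {δ e R : ℝ} (hδ0 : 0 < δ) (hδ1 : δ < 1) (hn : 1 ≤ n)
    (he1 : e ≤ 1) (heR : ((n : ℝ) - (n / 4 : ℕ)) / 2 * e ≤ R)
    (hR : 5 / 9 * R ≤ 5 / 4 * d * ∑ t ∈ Finset.Ico (n / 4) n, (1 : ℝ) / (t + 1) +
      2 * Real.log (1 / δ)) :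
    e ≤ 2 * 4.81 * ((d : ℝ) / n + 1 / n * Real.log (2 / δ)) := by
  have hn0 : (0 : ℝ) < n := by exact_mod_cast hn
  have hlog : Real.log (2 / δ) = Real.log 2 + Real.log (1 / δ) := by
    rw [← Real.log_mul (by norm_num) (by positivity)]
    congr 1
    ring
  have hlog0 : 0 ≤ Real.log (1 / δ) := Real.log_nonneg (by
    rw [le_div_iff₀ hδ0]
    linarith)
  have hlog2 := Real.log_two_gt_d9
  have hrhs : 2 * 4.81 * ((d : ℝ) / n + 1 / n * Real.log (2 / δ)) =
      9.62 * (d + Real.log (2 / δ)) / n := by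
    field_simp
    ring
  rw [hrhs, le_div_iff₀ hn0]
  have hd0 : (0 : ℝ) ≤ d := Nat.cast_nonneg d
  -- Here the claim is trivial, since `9.62 * (1 + log 2) > 16`. Otherwise the harmonic bound, or `d
  -- = 0`, gives the factor `2 * (9 / 5) * (8 / 3) = 9.6`.
  by_cases hcase : 1 ≤ d ∧ n ≤ 16
  · have h1 : (1 : ℝ) ≤ d := by exact_mod_cast hcase.1
    have h2 : (n : ℝ) ≤ 16 := by exact_mod_cast hcase.2
    have h3 : e * n ≤ 1 * n := by gcongr
    linarith
  · have hsum : 5 / 4 * d * ∑ t ∈ Finset.Ico (n / 4) n, (1 : ℝ) / (t + 1) ≤ 2 * d := by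
      rcases Nat.eq_zero_or_pos d with rfl | hd
      · simp
      · have := sum_Ico_quarter_inv_le (n := n) (by omega)
        calc _ ≤ 5 / 4 * (d : ℝ) * (8 / 5) := by gcongr
          _ = 2 * d := by ring
    have hm : ((n / 4 : ℕ) : ℝ) ≤ n / 4 := Nat.cast_div_le
    rcases le_or_gt e 0 with he | he
    · have : e * n ≤ 0 := mul_nonpos_of_nonpos_of_nonneg he hn0.le
      linarith
    · have h4 : (n : ℝ) * 3 / 8 * e ≤ R :=
        le_trans (mul_le_mul_of_nonneg_right (by linarith) he.le) heR
      linarith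

theorem sum_log_one_add_le (d n : ℕ) :
    ∑ t : Fin n, Real.log (1 + 5 / 4 * (if n / 4 ≤ t.1 then (d : ℝ) else 0) / (t + 1)) ≤
      5 / 4 * d * ∑ t ∈ Finset.Ico (n / 4) n, (1 : ℝ) / (t + 1) := by
  have h1 : (Finset.range n).filter (n / 4 ≤ ·) = Finset.Ico (n / 4) n := by
    ext
    simp [and_comm]
  rw [← h1, Finset.sum_filter, Finset.mul_sum, ← Fin.sum_univ_eq_sum_range
    (fun t => 5 / 4 * (d : ℝ) * if n / 4 ≤ t then (1 : ℝ) / (t + 1) else 0)]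
  refine Finset.sum_le_sum fun t _ => ?_
  split_ifs
  · have h2 : (0 : ℝ) < 1 + 5 / 4 * d / (t + 1) := by positivity
    have := Real.log_le_sub_one_of_pos h2
    calc _ ≤ _ := this
      _ = _ := by ring
  · simp

end PartialLearning

open PartialLearning in
theorem corollary4 {X : Type*} [MeasurableSpace X]
    (H : Set (PartialLearning.PHyp X)) (d : ℕ) (hd : PartialLearning.HasVCDim H d) :
    ∃ f : PartialLearning.Predictor X,
      ∀ (δ : ℝ), 0 < δ → δ < 1 →
      ∀ (n : ℕ), 1 ≤ n →
      ∀ (P : Measure (X × Bool)) [IsProbabilityMeasure P],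
        PartialLearning.Realizable H P → PartialLearning.PatternMeasurable H P →
        (Measure.pi fun _ : Fin n => P)
            {S : Fin n → X × Bool |
              ¬ PartialLearning.err (f n S) P
                  ≤ 2 * 4.81 * ((d : ℝ) / n + 1 / n * Real.log (2 / δ))}
          ≤ ENNReal.ofReal δ := by
  choose p hp01 hpu hps hpd using fun k => exists_equivariant_prediction (Fin k) d
  refine ⟨majorityPredictor H p, ?_⟩
  intro δ hδ0 hδ1 n hn P _ hreal hmeas
  let l : ∀ t, (Fin (t + 1) → X × Bool) → ℝ := fun t z =>
    if n / 4 ≤ t then lastLoss H p t z else 0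
  have hloss01 : ∀ t z, lastLoss H p t z ∈ Set.Icc (0 : ℝ) 1 := fun t z => by
    refine ⟨abs_nonneg _, abs_sub_le_iff.2 ⟨?_, ?_⟩⟩ <;>
    linarith [(hp01 _ (patterns H (Prod.fst ∘ z)) (Fin.last t) (Prod.snd ∘ z)).1,
      (hp01 _ (patterns H (Prod.fst ∘ z)) (Fin.last t) (Prod.snd ∘ z)).2,
      (bit_mem_Icc (z (Fin.last t)).2).1, (bit_mem_Icc (z (Fin.last t)).2).2]
  have hl01 : ∀ t z, l t z ∈ Set.Icc (0 : ℝ) 1 := fun t z => by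
    simp only [l]
    split_ifs
    exacts [hloss01 t z, by simp]
  have hlm : ∀ t, AEMeasurable (l t) (Measure.pi fun _ : Fin (t + 1) => P) := fun t => by
    by_cases ht : n / 4 ≤ t
    · simp only [l, ht, if_true]
      exact aemeasurable_of_patterns hmeas fun F v => |p (t + 1) F (Fin.last t) v -
        bit (v (Fin.last t))|
    · simp only [l, ht, if_false]
      exact aemeasurable_const
  -- Clipping puts the measurable version in `[0, 1]` everywhere, not just almost everywhere.
  let l' : ∀ t, (Fin (t + 1) → X × Bool) → ℝ := fun t z => max 0 (min 1 ((hlm t).mk (l t) z))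
  have hl' : ∀ t, Measurable (l' t) := fun t =>
    measurable_const.max (measurable_const.min (hlm t).measurable_mk)
  have hl01' : ∀ t z, l' t z ∈ Set.Icc (0 : ℝ) 1 := fun t z =>
    ⟨le_max_left _ _, max_le zero_le_one (min_le_left _ _)⟩
  have hll' : ∀ t, l t =ᵐ[Measure.pi fun _ => P] l' t := fun t => by
    filter_upwards [(hlm t).ae_eq_mk] with z hz
    simp only [l']
    rw [← hz, min_eq_right (hl01 t z).2, max_eq_right (hl01 t z).1]
  have hsymm : ∀ t (σ : Equiv.Perm (Fin (t + 1))), σ (Fin.last t) = Fin.last t →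
      ∀ z, l t (z ∘ σ) = l t z := fun t σ hσ z => by
    have h1 := hps (t + 1) (patterns H (Prod.fst ∘ z)) (Fin.last t) (Prod.snd ∘ z) σ
    rw [← patterns_comp_perm, hσ] at h1
    simp only [l, lastLoss, ← Function.comp_assoc, h1, Function.comp_apply, hσ]
  have hB : ∀ t, ∀ᵐ z ∂(Measure.pi fun _ : Fin (t + 1) => P),
      ∑ i, l t (z ∘ Equiv.swap i (Fin.last t)) ≤ if n / 4 ≤ t then (d : ℝ) else 0 := fun t => by
    by_cases ht : n / 4 ≤ t
    · simp only [l, ht, if_true]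
      filter_upwards [ae_mem_patterns hreal (t + 1)] with z hz
      refine le_trans (le_of_eq (Finset.sum_congr rfl fun i _ => ?_))
        (hpd _ _ (vcDimLE_patterns hd (Prod.fst ∘ z)) _ hz)
      -- Equivariance identifies the last loss after the swap with the loss at coordinate `i` in the
      -- original order.
      have h1 := hps (t + 1) (patterns H (Prod.fst ∘ z)) (Fin.last t) (Prod.snd ∘ z)
        (Equiv.swap i (Fin.last t))
      rw [← patterns_comp_perm, Equiv.swap_apply_right] at h1
      simp only [lastLoss, ← Function.comp_assoc, h1, Function.comp_apply,
        Equiv.swap_apply_right]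
    · simp [l, ht]
  -- The choice `η = log (9 / 4)` makes the two factors `exp η - 1 = 5 / 4` and `1 - exp (-η) = 5 /
  -- 9`.
  have hexp : Real.exp (Real.log (9 / 4)) = 9 / 4 := Real.exp_log (by norm_num)
  have main := measure_sum_nextRisk_gt_le P (n := n) hll' hl' hl01 hl01' hsymm
    (fun t => by split_ifs <;> simp) hB (η := Real.log (9 / 4))
    (Real.log_nonneg (by norm_num)) hδ0
  refine le_trans (measure_mono_ae ?_) main
  -- By Fubini, for almost every sample the two versions of the loss agree at almost every test
  -- point.
  have hslice : ∀ᵐ S ∂(Measure.pi fun _ : Fin n => P), ∀ t : Fin n, ∀ᵐ z ∂P,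
      l t (Fin.snoc (S ∘ Fin.castLE t.2.le) z) = l' t (Fin.snoc (S ∘ Fin.castLE t.2.le) z) := by
    refine ae_all_iff.2 fun t => ?_
    have h1 := Measure.ae_ae_of_ae_prod
      ((measurePreserving_snoc P t).quasiMeasurePreserving.ae (hll' t))
    exact (measurePreserving_comp_injective P (Fin.castLE t.2.le)
      (Fin.castLE_injective _)).quasiMeasurePreserving.ae h1
  filter_upwards [hslice] with S hS hbad
  by_contra hgood
  refine hbad ?_
  have hgood' := not_lt.1 hgood
  rw [Real.exp_neg, hexp] at hgood'
  have heR := err_majorityPredictor_le (H := H) (p := p) hl' hl01' fun t => by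
    filter_upwards [hS t] with z hz
    rw [← hz, ← lastLoss_snoc H hpu]
  refine risk_bound_of_sum_le hδ0 hδ1 hn measureReal_le_one heR ?_
  have h3 := sum_log_one_add_le d n
  norm_num at hgood' h3 ⊢
  linarith
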